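/- Consider the N-1-1 dual-hop amplify-and-forward system ($N\ge 1$) with source power $P>0$, relay power $P_r>0$, interference power $P_I\ge 0$ and noise power $N_0>0$. The source-relay channel $\mathbf h_1\in\mathbb C^{1\times N}$ has i.i.d. $\mathcal{CN}(0,\sigma_1^2)$ entries, the relay-destination channel is $h_2\sim\mathcal{CN}(0,\sigma_2^2)$, the interference-relay channel is $h_I\sim\mathcal{CN}(0,\sigma_I^2)$ (all circularly symmetric, $\sigma_1,\sigma_2,\sigma_I>0$), and $\mathbf h_1,h_2,h_I$ are independent. With matched transmit beamforming $\mathbf w_t=\mathbf h_1^\dagger/|\mathbf h_1|$ and the fixed relaying gain $w^2=P_r/(NP\sigma_1^2+P_I\sigma_I^2+N_0)$, the end-to-end SINR is $$\gamma=\frac{w^2|h_2|^2|\mathbf h_1\mathbf w_t|^2P}{w^2|h_2|^2|h_I|^2P_I+w^2|h_2|^2N_0+N_0},$$ and the outage probability at the threshold $\gamma_{th}>0$ is $P_{out}(\gamma_{th})=\Pr(\gamma\le\gamma_{th})$. Put $\rho_1=P\sigma_1^2/N_0$, $\rho_2=P_r\sigma_2^2/N_0$, $\rho_I=P_I\sigma_I^2/N_0$.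 Fix $N\ge1$, $\mu>0$, $\rho_I\ge 0$ and $\gamma_{th}>0$, and let $\rho_2=\mu\rho_1$, $\rho_1\to\infty$. Let $$A(\rho_1)=\begin{cases}\left(\frac1\mu\left(\ln\frac{\mu\rho_1}{\gamma_{th}}+\psi(1)+\psi(2)\right)+\rho_I+1\right)\frac{\gamma_{th}}{\rho_1}, & N=1,\\[1ex] \frac{N}{\mu(N-1)}\,\frac{\gamma_{th}}{\rho_1}, & N\ge2,\end{cases}$$ where $\psi$ is the digamma function. Then $P_{out}(\gamma_{th})=A(\rho_1)+o(1/\rho_1)$; in particular $P_{out}(\gamma_{th})/A(\rho_1)\to1$, and the diversity order is one: $$\lim_{\rho_1\to\infty}\frac{-\ln P_{out}(\gamma_{th})}{\ln\rho_1}=1.$$ -/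

import Mathlib

open MeasureTheory ProbabilityTheory Filter Topology Asymptotics

noncomputable section

namespace DualHop

/-- The circularly symmetric complex Gaussian law of mean `0` and variance `σ ^ 2`: independent real
and imaginary parts, each a real Gaussian of mean `0` and variance `σ ^ 2 / 2`. -/
def complexGaussian (σ : ℝ) : Measure ℂ :=
  ((gaussianReal 0 (Real.toNNReal (σ ^ 2 / 2))).prod
    (gaussianReal 0 (Real.toNNReal (σ ^ 2 / 2)))).map Complex.measurableEquivRealProd.symm

/-- The deterministic parameters of the dual-hop system: source power `P`, relay power `Pr`,
interference power `PI`, noise power `N0`, and standard deviations of the entries of the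
source-relay channel (`σ1`), the relay-destination channel (`σ2`) and the interference-relay
channel (`σI`). -/
structure SystemParams where
  P : ℝ
  Pr : ℝ
  PI : ℝ
  N0 : ℝ
  σ1 : ℝ
  σ2 : ℝ
  σI : ℝ
  P_pos : 0 < P
  Pr_pos : 0 < Pr
  PI_nonneg : 0 ≤ PI
  N0_pos : 0 < N0
  σ1_pos : 0 < σ1
  σ2_pos : 0 < σ2
  σI_pos : 0 < σI

namespace SystemParams

/-- `ρ₁ = P σ₁² / N₀`. -/
def rho1 (S : SystemParams) : ℝ := S.P * S.σ1 ^ 2 / S.N0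

/-- `ρ₂ = P_r σ₂² / N₀`. -/
def rho2 (S : SystemParams) : ℝ := S.Pr * S.σ2 ^ 2 / S.N0

/-- `ρ_I = P_I σ_I² / N₀`. -/
def rhoI (S : SystemParams) : ℝ := S.PI * S.σI ^ 2 / S.N0

/-- The joint law of the channels `(h₁, h₂, h_I)` of the N-1-1 system: `h₁` has `N` i.i.d. entries,
and `h₁`, `h₂`, `h_I` are mutually independent. -/
def channelLaw (S : SystemParams) (N : ℕ) : Measure ((Fin N → ℂ) × ℂ × ℂ) :=
  (Measure.pi fun _ : Fin N => complexGaussian S.σ1).prod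
    ((complexGaussian S.σ2).prod (complexGaussian S.σI))

/-- The squared fixed relaying gain `w² = P_r / (N P σ₁² + P_I σ_I² + N₀)`. -/
def fixedGainSq (S : SystemParams) (N : ℕ) : ℝ :=
  S.Pr / (N * S.P * S.σ1 ^ 2 + S.PI * S.σI ^ 2 + S.N0)

/-- The end-to-end SINR for squared relaying gain `wsq`, transmit beamforming vector `wt` and
channel realization `h₁`, `h₂`, `h_I`. -/
def sinr (S : SystemParams) {N : ℕ} (wsq : ℝ) (wt h1 : Fin N → ℂ) (h2 hI : ℂ) : ℝ :=
  (wsq * ‖h2‖ ^ 2 * ‖h1 ⬝ᵥ wt‖ ^ 2 * S.P) /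
    (wsq * ‖h2‖ ^ 2 * ‖hI‖ ^ 2 * S.PI + wsq * ‖h2‖ ^ 2 * S.N0 + S.N0)

end SystemParams

/-- The beamforming vector matched to the first hop, `w_t = h₁† / |h₁|` (Euclidean norm). -/
def matchedBeam {N : ℕ} (h1 : Fin N → ℂ) : Fin N → ℂ :=
  fun i => star (h1 i) / (‖WithLp.toLp 2 h1‖ : ℂ)

/-- The outage probability `Pr (γ ≤ γ_th)` of the N-1-1 system with matched beamforming and
fixed-gain relaying. -/
def outageProb (S : SystemParams) (N : ℕ) (γth : ℝ) : ℝ :=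
  (S.channelLaw N).real
    {h | S.sinr (S.fixedGainSq N) (matchedBeam h.1) h.1 h.2.1 h.2.2 ≤ γth}

/-- The digamma function at a real argument. -/
def digamma (x : ℝ) : ℝ := (Complex.digamma (x : ℂ)).re

/-- The high-SNR approximation of the outage probability, as a function of `ρ₁`. -/
def highSNRApprox (N : ℕ) (μ ρI γth ρ1 : ℝ) : ℝ :=
  if N = 1 then
    (1 / μ * (Real.log (μ * ρ1 / γth) + digamma 1 + digamma 2) + ρI + 1) * (γth / ρ1)
  else
    N / (μ * (N - 1)) * (γth / ρ1)

end DualHop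

end

/-!
In the normalized powers `X = ‖h₁‖² / σ₁²`, `Y = |h₂|² / σ₂²`, `Z = |h_I|² / σ_I²`, the outage event
reads `X ≤ ε (ρ_I Z + 1 + c / Y)` with `ε = γ_th / ρ₁` and `c = (N ρ₁ + ρ_I + 1) / ρ₂ → N / μ`
(`outageProb_eq_normalizedOutage`). Here `Y`, `Z` are exponential of rate one and `X` is a sum of `N`
such variables, all independent, because the squared modulus of a circularly symmetric Gaussian is
exponential (`map_norm_sq_complexGaussian`).

For `N ≥ 2`, condition on `X` and `Z`: the conditional probability divided by `ε` tends to
`(N / μ) / X` and is bounded by `2 (ρ_I Z + 1 + c) / X`, which is integrable as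
`𝔼[1 / X] = 1 / (N - 1)` is finite (`lintegral_inv_sum`). Dominated convergence gives the leading
term `N / (μ (N - 1))` (`tendsto_normalizedOutage_div`).

For `N = 1`, `1 / X` is not integrable, and this is where the logarithm comes from. Conditioning on
`Y` and `Z` gives the exact formula `1 - exp (-ε) (1 + ε ρ_I)⁻¹ 𝔼[exp (-ε c / Y)]`
(`normalizedOutage_one`), so what is needed is the expansion
`(1 - 𝔼[exp (-δ / Y)]) / δ = -log δ + 1 - 2γ + o(1)` (`tendsto_one_sub_integral_exp_neg_div`), in
which `1 - 2γ = ψ(1) + ψ(2)`. Substituting `y = δ u`, the left-hand side is the Laplace transform at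
`δ` of `1 - exp (-1 / u)`. Subtracting `1 / (1 + u)` leaves a nonnegative integrable function of
integral `1 - γ` (`integral_regularized`), while the Laplace transform of `1 / (1 + u)` is
`exp δ * E₁ δ = -log δ - γ + o(1)`. Both evaluations rest on
`∫ x > 0, exp (-x) log x = Γ'(1) = -γ`.

Finally `P_out = (B + o(1)) γ_th / ρ₁` with `B` bounded below and at most logarithmic, which contains
the three assertions (`highSNR_of_tendsto_sub`).
-/

namespace DualHop

/-! ### Channel laws and the normalized outage event -/

instance isProbabilityMeasure_expMeasure_one : IsProbabilityMeasure (expMeasure 1) :=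
  isProbabilityMeasure_expMeasure one_pos

lemma integral_expMeasure_one {E : Type*} [NormedAddCommGroup E] [NormedSpace ℝ E] (f : ℝ → E) :
    ∫ x, f x ∂expMeasure 1 = ∫ x in Set.Ioi 0, Real.exp (-x) • f x := by
  have h : ∀ x, (gammaPDF 1 1 x).toReal • f x
      = (Set.Ici (0 : ℝ)).indicator (fun x => Real.exp (-x) • f x) x := by
    intro x
    by_cases hx : 0 ≤ x
    · simp [gammaPDF, gammaPDFReal, hx, (Real.exp_pos _).le]
    · simp [gammaPDF, gammaPDFReal, hx]
  rw [expMeasure, gammaMeasure, integral_withDensity_eq_integral_toReal_smul (f := gammaPDF 1 1)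
    (measurable_gammaPDFReal 1 1).ennreal_ofReal (ae_of_all _ fun _ => ENNReal.ofReal_lt_top)]
  simp_rw [h]
  rw [integral_indicator measurableSet_Ici, integral_Ici_eq_integral_Ioi]

lemma ae_pos_expMeasure_one : ∀ᵐ x ∂expMeasure 1, 0 < x := by
  have h : expMeasure 1 (Set.Iic 0) = 0 := by
    rw [← measureReal_eq_zero_iff, ← cdf_eq_real, cdf_expMeasure_eq one_pos]
    simp
  filter_upwards [measure_eq_zero_iff_ae_notMem.1 h] with x hx using not_le.1 hx

lemma measureReal_expMeasure_one_Iic {t : ℝ} (ht : 0 ≤ t) :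
    (expMeasure 1).real (Set.Iic t) = 1 - Real.exp (-t) := by
  rw [← cdf_eq_real, cdf_expMeasure_eq one_pos, if_pos ht, one_mul]

instance isProbabilityMeasure_complexGaussian (σ : ℝ) :
    IsProbabilityMeasure (complexGaussian σ) := by
  unfold complexGaussian
  exact Measure.isProbabilityMeasure_map (by fun_prop)

/-- With variance `σ ^ 2 / 2`, the Fourier transform of the law of `x ^ 2 / σ ^ 2` is a square root of
`1 / (1 - t * I)`; the statement is squared because only the product over the real and imaginary
parts is needed, which also avoids choosing a branch of the root. -/
lemma integral_gaussianReal_cexp_sq {σ : ℝ} (hσ : 0 < σ) (t : ℝ) :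
    (∫ x, Complex.exp (t * (x ^ 2 / σ ^ 2 : ℝ) * Complex.I)
      ∂gaussianReal 0 (Real.toNNReal (σ ^ 2 / 2))) ^ 2 = 1 / (1 - t * Complex.I) := by
  have hv : Real.toNNReal (σ ^ 2 / 2) ≠ 0 := by
    rw [ne_eq, Real.toNNReal_eq_zero, not_le]; positivity
  have hv' : ((Real.toNNReal (σ ^ 2 / 2) : NNReal) : ℝ) = σ ^ 2 / 2 :=
    Real.coe_toNNReal _ (by positivity)
  have hσ' : (σ : ℂ) ≠ 0 := by exact_mod_cast hσ.ne'
  have ht : (1 - t * Complex.I : ℂ) ≠ 0 := by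
    intro h; simpa using congrArg Complex.re h
  have hb : 0 < ((1 - t * Complex.I) / σ ^ 2 : ℂ).re := by
    rw [← Complex.ofReal_pow, Complex.div_ofReal_re]
    simp; positivity
  rw [integral_gaussianReal_eq_integral_smul hv]
  have h : ∀ x : ℝ, gaussianPDFReal 0 (Real.toNNReal (σ ^ 2 / 2)) x •
      Complex.exp (t * (x ^ 2 / σ ^ 2 : ℝ) * Complex.I)
      = ((√(Real.pi * σ ^ 2))⁻¹ : ℝ) * Complex.exp (-((1 - t * Complex.I) / σ ^ 2) * x ^ 2) := by
    intro x
    rw [gaussianPDFReal, hv', Complex.real_smul, Complex.ofReal_mul, mul_assoc,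
      Complex.ofReal_exp, ← Complex.exp_add]
    congr 1
    · rw [show 2 * Real.pi * (σ ^ 2 / 2) = Real.pi * σ ^ 2 by ring]
    · congr 1; push_cast; field_simp; ring
  simp_rw [h]
  rw [integral_const_mul, integral_gaussian_complex hb, mul_pow, ← Complex.ofReal_pow, inv_pow,
    Real.sq_sqrt (by positivity), one_div, ← Nat.cast_two (R := ℂ),
    Complex.cpow_nat_inv_pow _ two_ne_zero]
  have hpi : (Real.pi : ℂ) ≠ 0 := by exact_mod_cast Real.pi_ne_zero
  push_cast
  field_simp

/-- The normalized power of a circularly symmetric Gaussian channel (Rayleigh fading) is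
exponentially distributed with rate `1`; the two laws have the same characteristic function. -/
lemma map_norm_sq_complexGaussian {σ : ℝ} (hσ : 0 < σ) :
    (complexGaussian σ).map (fun z => ‖z‖ ^ 2 / σ ^ 2) = expMeasure 1 := by
  have hm : Measurable fun z : ℂ => ‖z‖ ^ 2 / σ ^ 2 := by fun_prop
  have : IsProbabilityMeasure ((complexGaussian σ).map fun z => ‖z‖ ^ 2 / σ ^ 2) :=
    Measure.isProbabilityMeasure_map hm.aemeasurable
  refine Measure.ext_of_charFun (funext fun t => ?_)
  have ht : (1 - t * Complex.I : ℂ) ≠ 0 := by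
    intro h; simpa using congrArg Complex.re h
  rw [charFun_apply_real, charFun_apply_real, integral_map hm.aemeasurable (by fun_prop),
    complexGaussian, integral_map (by fun_prop) (by fun_prop), integral_expMeasure_one]
  have h1 : ∀ p : ℝ × ℝ, Complex.exp (t * ((‖Complex.measurableEquivRealProd.symm p‖ ^ 2 / σ ^ 2 : ℝ))
      * Complex.I) = Complex.exp (t * (p.1 ^ 2 / σ ^ 2 : ℝ) * Complex.I)
        * Complex.exp (t * (p.2 ^ 2 / σ ^ 2 : ℝ) * Complex.I) := by
    intro p
    rw [← Complex.exp_add, Complex.sq_norm, Complex.normSq_apply]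
    simp only [Complex.measurableEquivRealProd_symm_apply]
    congr 1; push_cast; ring
  have h2 : ∀ x : ℝ, Real.exp (-x) • Complex.exp (t * x * Complex.I)
      = Complex.exp ((t * Complex.I - 1) * x) := by
    intro x
    rw [Complex.real_smul, Complex.ofReal_exp, ← Complex.exp_add]
    congr 1; push_cast; ring
  simp_rw [h1, h2]
  rw [integral_prod_mul (fun x : ℝ => Complex.exp (t * (x ^ 2 / σ ^ 2 : ℝ) * Complex.I))
    (fun x : ℝ => Complex.exp (t * (x ^ 2 / σ ^ 2 : ℝ) * Complex.I)), ← sq,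
    integral_gaussianReal_cexp_sq hσ,
    integral_exp_mul_complex_Ioi (by simp)]
  have ht' : (t * Complex.I - 1 : ℂ) ≠ 0 := by rwa [← neg_ne_zero, neg_sub]
  simp only [Complex.ofReal_zero, mul_zero, Complex.exp_zero]
  field_simp
  ring

/-- The outage probability in normalized variables: `p.1` lists the `N` normalized first-hop powers,
`p.2.1` is the normalized second-hop power and `p.2.2` the normalized interference power, all
independent exponential variables of rate `1`. The outage condition
`X ≤ ε * (ρI * Z + 1 + c / Y)` is multiplied by `Y`, so that no division by zero occurs. -/
noncomputable def normalizedOutage (N : ℕ) (ρI ε c : ℝ) : ℝ :=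
  ((Measure.pi fun _ : Fin N => expMeasure 1).prod ((expMeasure 1).prod (expMeasure 1))).real
    {p | (∑ i, p.1 i) * p.2.1 ≤ ε * ((ρI * p.2.2 + 1) * p.2.1 + c)}

/-- Matched beamforming collects the full power of `h`. This remains true for `h = 0`, where the
beam is `0 / 0 = 0`. -/
lemma norm_dotProduct_matchedBeam_sq {N : ℕ} (h : Fin N → ℂ) :
    ‖h ⬝ᵥ matchedBeam h‖ ^ 2 = ∑ i, ‖h i‖ ^ 2 := by
  have hn : ‖WithLp.toLp 2 h‖ ^ 2 = ∑ i, ‖h i‖ ^ 2 := by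
    rw [EuclideanSpace.norm_sq_eq]
  have h1 : h ⬝ᵥ matchedBeam h = ((∑ i, ‖h i‖ ^ 2 : ℝ) : ℂ) / (‖WithLp.toLp 2 h‖ : ℂ) := by
    simp only [dotProduct, matchedBeam, ← mul_div_assoc, ← Finset.sum_div]
    congr 1
    push_cast
    exact Finset.sum_congr rfl fun i _ => Complex.mul_conj' (h i)
  rw [h1, ← hn, ← Complex.ofReal_div, Complex.norm_real, Real.norm_eq_abs, sq_abs]
  rcases eq_or_ne ‖WithLp.toLp 2 h‖ 0 with h0 | h0
  · simp [h0]
  · field_simp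

lemma SystemParams.rhoI_nonneg (S : SystemParams) : 0 ≤ S.rhoI := by
  have := S.PI_nonneg; have := S.σI_pos; have := S.N0_pos
  unfold SystemParams.rhoI; positivity

lemma SystemParams.sinr_le_iff (S : SystemParams) {N : ℕ} (γth : ℝ) (h1 : Fin N → ℂ) (h2 hI : ℂ) :
    S.sinr (S.fixedGainSq N) (matchedBeam h1) h1 h2 hI ≤ γth ↔
      (∑ i, ‖h1 i‖ ^ 2 / S.σ1 ^ 2) * (‖h2‖ ^ 2 / S.σ2 ^ 2) ≤
        γth / S.rho1 * ((S.rhoI * (‖hI‖ ^ 2 / S.σI ^ 2) + 1) * (‖h2‖ ^ 2 / S.σ2 ^ 2)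
          + (N * S.rho1 + S.rhoI + 1) / S.rho2) := by
  have hP := S.P_pos
  have hPr := S.Pr_pos
  have hPI := S.PI_nonneg
  have hN0 := S.N0_pos
  have h1' := S.σ1_pos
  have h2' := S.σ2_pos
  have hI' := S.σI_pos
  have hD : 0 < N * S.P * S.σ1 ^ 2 + S.PI * S.σI ^ 2 + S.N0 := by positivity
  have hw : 0 < S.fixedGainSq N := div_pos hPr hD
  rw [SystemParams.sinr, norm_dotProduct_matchedBeam_sq, div_le_iff₀ (by positivity),
    ← Finset.sum_div]
  generalize (∑ i, ‖h1 i‖ ^ 2) = X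
  generalize ‖h2‖ ^ 2 = Y
  generalize ‖hI‖ ^ 2 = Z
  -- the two inequalities differ by the positive factor `k * (σ1 ^ 2 * σ2 ^ 2)`
  set k := S.Pr * S.P / (N * S.P * S.σ1 ^ 2 + S.PI * S.σI ^ 2 + S.N0) with hk
  have hk0 : 0 < k := by positivity
  have e1 : S.fixedGainSq N * Y * X * S.P
      = k * (S.σ1 ^ 2 * S.σ2 ^ 2) * (X / S.σ1 ^ 2 * (Y / S.σ2 ^ 2)) := by
    rw [hk, SystemParams.fixedGainSq]; field_simp
  have e2 : γth * (S.fixedGainSq N * Y * Z * S.PI + S.fixedGainSq N * Y * S.N0 + S.N0)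
      = k * (S.σ1 ^ 2 * S.σ2 ^ 2) * (γth / S.rho1 * ((S.rhoI * (Z / S.σI ^ 2) + 1)
        * (Y / S.σ2 ^ 2) + (N * S.rho1 + S.rhoI + 1) / S.rho2)) := by
    rw [hk, SystemParams.fixedGainSq, SystemParams.rho1, SystemParams.rho2, SystemParams.rhoI]
    field_simp
  rw [e1, e2]
  exact mul_le_mul_iff_right₀ (by positivity)

lemma outageProb_eq_normalizedOutage (S : SystemParams) (N : ℕ) (γth : ℝ) :
    outageProb S N γth
      = normalizedOutage N S.rhoI (γth / S.rho1) ((N * S.rho1 + S.rhoI + 1) / S.rho2) := by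
  have key : ∀ σ : ℝ, 0 < σ →
      MeasurePreserving (fun z : ℂ => ‖z‖ ^ 2 / σ ^ 2) (complexGaussian σ) (expMeasure 1) :=
    fun σ hσ => ⟨by fun_prop, map_norm_sq_complexGaussian hσ⟩
  have hmp := (measurePreserving_pi (fun _ : Fin N => complexGaussian S.σ1)
    (fun _ => expMeasure 1) fun _ => key _ S.σ1_pos).prod
      ((key _ S.σ2_pos).prod (key _ S.σI_pos))
  rw [outageProb, normalizedOutage, SystemParams.channelLaw, ← hmp.measureReal_preimage]
  · congr 1
    ext h
    exact S.sinr_le_iff γth h.1 h.2.1 h.2.2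
  · exact (measurableSet_le (by fun_prop) (by fun_prop)).nullMeasurableSet

/-! ### Several transmit antennas -/

lemma integral_exp_neg_mul_expMeasure_one {t : ℝ} (ht : 0 ≤ t) :
    ∫ x, Real.exp (-(t * x)) ∂expMeasure 1 = (1 + t)⁻¹ := by
  rw [integral_expMeasure_one]
  have h : ∀ x : ℝ, Real.exp (-x) • Real.exp (-(t * x)) = Real.exp (-(1 + t) * x) := by
    intro x
    rw [smul_eq_mul, ← Real.exp_add]
    congr 1; ring
  simp_rw [h]
  rw [integral_exp_mul_Ioi (by linarith)]
  rw [mul_zero, Real.exp_zero, neg_div_neg_eq, one_div]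

lemma integral_exp_neg_mul_sum (N : ℕ) {t : ℝ} (ht : 0 ≤ t) :
    ∫ x, Real.exp (-(t * ∑ i, x i)) ∂(Measure.pi fun _ : Fin N => expMeasure 1)
      = ((1 + t) ^ N)⁻¹ := by
  simp_rw [Finset.mul_sum, ← Finset.sum_neg_distrib, Real.exp_sum]
  rw [integral_fintype_prod_eq_pow (fun x => Real.exp (-(t * x))),
    integral_exp_neg_mul_expMeasure_one ht, Fintype.card_fin, inv_pow]

lemma ae_sum_pos {N : ℕ} (hN : 1 ≤ N) :
    ∀ᵐ x ∂(Measure.pi fun _ : Fin N => expMeasure 1), 0 < ∑ i, x i := by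
  have h : ∀ᵐ x ∂(Measure.pi fun _ : Fin N => expMeasure 1), ∀ i, 0 < x i :=
    ae_all_iff.2 fun i =>
      (measurePreserving_eval (fun _ : Fin N => expMeasure 1) i).quasiMeasurePreserving.ae
        ae_pos_expMeasure_one
  have : NeZero N := ⟨by omega⟩
  filter_upwards [h] with x hx
  exact Finset.sum_pos (fun i _ => hx i) Finset.univ_nonempty

lemma lintegral_inv_one_add_pow (n : ℕ) :
    ∫⁻ t in Set.Ioi (0 : ℝ), ENNReal.ofReal (((1 + t) ^ (n + 2))⁻¹)
      = ENNReal.ofReal (1 / (n + 1)) := by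
  have hd : ∀ t ∈ Set.Ici (0 : ℝ),
      HasDerivAt (fun t : ℝ => -(((1 + t) ^ (n + 1))⁻¹ / (n + 1))) (((1 + t) ^ (n + 2))⁻¹) t := by
    intro t ht
    have ht' : (1 + t) ≠ 0 := by have : (0 : ℝ) ≤ t := ht; positivity
    have h := ((((hasDerivAt_id t).const_add 1).pow (n + 1)).inv (pow_ne_zero _ ht')).div_const
      ((n : ℝ) + 1) |>.neg
    refine h.congr_deriv ?_
    simp only [id, Nat.add_sub_cancel, Pi.pow_apply]
    push_cast
    field_simp
    ring
  have hl : Tendsto (fun t : ℝ => -(((1 + t) ^ (n + 1))⁻¹ / (n + 1))) atTop (𝓝 0) := by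
    have h1 : Tendsto (fun t : ℝ => (1 + t) ^ (n + 1)) atTop atTop :=
      (tendsto_pow_atTop (by omega)).comp (tendsto_atTop_add_const_left _ _ tendsto_id)
    simpa using (h1.inv_tendsto_atTop.div_const ((n : ℝ) + 1)).neg
  have hp : ∀ t ∈ Set.Ioi (0 : ℝ), 0 ≤ ((1 + t) ^ (n + 2))⁻¹ := by
    intro t ht
    have : (0 : ℝ) < t := ht
    positivity
  rw [← ofReal_integral_eq_lintegral_ofReal (integrableOn_Ioi_deriv_of_nonneg' hd hp hl)
      ((ae_restrict_iff' measurableSet_Ioi).2 (ae_of_all _ hp)),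
    integral_Ioi_of_hasDerivAt_of_nonneg' hd hp hl]
  simp

/-- The expectation of `1 / X` for a sum `X` of `n + 2` independent exponential variables, from
`1 / X = ∫ t > 0, exp (-t X)`, Tonelli, and the Laplace transform `(1 + t) ^ (-(n + 2))` of `X`.
It is finite exactly because there are at least two summands. -/
lemma lintegral_inv_sum (n : ℕ) :
    ∫⁻ x, ENNReal.ofReal ((∑ i, x i)⁻¹) ∂(Measure.pi fun _ : Fin (n + 2) => expMeasure 1)
      = ENNReal.ofReal (1 / (n + 1)) := by
  have h1 : ∀ s : ℝ, 0 < s → ENNReal.ofReal s⁻¹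
      = ∫⁻ t in Set.Ioi (0 : ℝ), ENNReal.ofReal (Real.exp (-(t * s))) := by
    intro s hs
    have h : ∀ t : ℝ, Real.exp (-(t * s)) = Real.exp (-s * t) := fun t => by ring_nf
    simp_rw [h]
    rw [← ofReal_integral_eq_lintegral_ofReal (integrableOn_exp_mul_Ioi (by linarith) 0)
      (ae_of_all _ fun t => (Real.exp_pos _).le), integral_exp_mul_Ioi (by linarith)]
    simp
  rw [lintegral_congr_ae ((ae_sum_pos (by omega)).mono fun x hx => h1 _ hx),
    lintegral_lintegral_swap (by fun_prop), ← lintegral_inv_one_add_pow n]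
  refine setLIntegral_congr_fun measurableSet_Ioi fun t ht => ?_
  have ht' : (0 : ℝ) < t := ht
  have hi : Integrable (fun x : Fin (n + 2) → ℝ => Real.exp (-(t * ∑ i, x i)))
      (Measure.pi fun _ : Fin (n + 2) => expMeasure 1) := by
    refine .of_integral_ne_zero ?_
    rw [integral_exp_neg_mul_sum _ ht'.le]
    positivity
  rw [← ofReal_integral_eq_lintegral_ofReal hi (ae_of_all _ fun t => (Real.exp_pos _).le),
    integral_exp_neg_mul_sum _ ht'.le]

lemma integrable_inv_sum (n : ℕ) :
    Integrable (fun x => (∑ i, x i)⁻¹) (Measure.pi fun _ : Fin (n + 2) => expMeasure 1) := by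
  refine ⟨by fun_prop, ?_⟩
  rw [hasFiniteIntegral_iff_ofReal ((ae_sum_pos (by omega)).mono fun x hx => (inv_pos.2 hx).le),
    lintegral_inv_sum]
  exact ENNReal.ofReal_lt_top

lemma integral_inv_sum (n : ℕ) :
    ∫ x, (∑ i, x i)⁻¹ ∂(Measure.pi fun _ : Fin (n + 2) => expMeasure 1) = 1 / (n + 1) := by
  rw [integral_eq_lintegral_of_nonneg_ae
      ((ae_sum_pos (by omega)).mono fun x hx => (inv_pos.2 hx).le) (by fun_prop),
    lintegral_inv_sum, ENNReal.toReal_ofReal (by positivity)]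

lemma integrable_id_expMeasure_one : Integrable (fun x => x) (expMeasure 1) := by
  refine .of_integral_ne_zero ?_
  rw [integral_expMeasure_one]
  have := Real.Gamma_eq_integral (s := 2) two_pos
  rw [Real.Gamma_two] at this
  norm_num at this
  simp [← this]

lemma measureReal_prod_eq_integral {α β : Type*} [MeasurableSpace α] [MeasurableSpace β]
    (μ : Measure α) (ν : Measure β) [IsFiniteMeasure μ] [IsFiniteMeasure ν] {s : Set (α × β)}
    (hs : MeasurableSet s) :
    (μ.prod ν).real s = ∫ x, ν.real (Prod.mk x ⁻¹' s) ∂μ := by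
  rw [measureReal_def, Measure.prod_apply hs, ← integral_toReal
    (measurable_measure_prodMk_left hs).aemeasurable (ae_of_all _ fun x => measure_lt_top _ _)]
  rfl

/-- The outage probability, conditioned on the first-hop and interference powers. -/
lemma normalizedOutage_eq_integral (N : ℕ) (ρI ε c : ℝ) :
    normalizedOutage N ρI ε c = ∫ q, (expMeasure 1).real
      {y | (∑ i, q.1 i) * y ≤ ε * ((ρI * q.2 + 1) * y + c)}
      ∂((Measure.pi fun _ : Fin N => expMeasure 1).prod (expMeasure 1)) := by
  set 𝓧 := Measure.pi fun _ : Fin N => expMeasure 1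
  have hs : MeasurableSet {p : ((Fin N → ℝ) × ℝ) × ℝ |
      (∑ i, p.1.1 i) * p.2 ≤ ε * ((ρI * p.1.2 + 1) * p.2 + c)} :=
    measurableSet_le (by fun_prop) (by fun_prop)
  have hmp : MeasurePreserving
      (fun p : (Fin N → ℝ) × ℝ × ℝ => ((p.1, p.2.2), p.2.1))
      (𝓧.prod ((expMeasure 1).prod (expMeasure 1)))
      ((𝓧.prod (expMeasure 1)).prod (expMeasure 1)) :=
    (measurePreserving_prodAssoc 𝓧 (expMeasure 1) (expMeasure 1)).symm.comp
      ((MeasurePreserving.id 𝓧).prod Measure.measurePreserving_swap)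
  have h := measureReal_prod_eq_integral (𝓧.prod (expMeasure 1)) (expMeasure 1) hs
  rw [← hmp.measureReal_preimage hs.nullMeasurableSet] at h
  exact h

lemma expMeasure_one_section_eq {X W ε c : ℝ} (hε : 0 < ε) (hc : 0 < c) (hX : ε * W < X) :
    (expMeasure 1).real {y | X * y ≤ ε * (W * y + c)}
      = 1 - Real.exp (-(ε * (c / (X - ε * W)))) := by
  have hX' : 0 < X - ε * W := sub_pos.2 hX
  rw [← measureReal_expMeasure_one_Iic (by positivity)]
  congr 1
  ext y
  rw [Set.mem_ofPred_eq, Set.mem_Iic, ← mul_div_assoc, le_div_iff₀ hX']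
  constructor <;> intro h <;> nlinarith

/-- A bound uniform in `ε` for the conditional outage probability divided by `ε`. If
`X ≤ 2 * ε * W`, it follows from bounding the probability by `1`; otherwise
`X - ε * W ≥ X / 2`. -/
lemma expMeasure_one_section_div_le {X W ε c : ℝ} (hε : 0 < ε) (hc : 0 < c) (hX : 0 < X)
    (hW : 0 < W) :
    (expMeasure 1).real {y | X * y ≤ ε * (W * y + c)} / ε ≤ 2 * (W + c) * X⁻¹ := by
  rw [div_le_iff₀ hε]
  rcases le_or_gt X (2 * (ε * W)) with h | h
  · refine measureReal_le_one.trans ?_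
    rw [mul_right_comm, ← div_eq_mul_inv, le_div_iff₀ hX]
    nlinarith [mul_pos hε hc]
  · have hk : c / (X - ε * W) ≤ 2 * (W + c) * X⁻¹ := by
      rw [← div_eq_mul_inv, div_le_div_iff₀ (by nlinarith [mul_pos hε hW]) hX]
      nlinarith [mul_pos hε hW, mul_pos hW hX, mul_pos hc hX]
    rw [expMeasure_one_section_eq hε hc (by nlinarith [mul_pos hε hW])]
    have := Real.add_one_le_exp (-(ε * (c / (X - ε * W))))
    nlinarith [mul_le_mul_of_nonneg_left hk hε.le]

lemma tendsto_expMeasure_one_section_div {ι : Type*} {l : Filter ι} {ε c : ι → ℝ} {c₀ X W : ℝ}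
    (hε : ∀ᶠ i in l, 0 < ε i) (hε0 : Tendsto ε l (𝓝 0)) (hc : ∀ᶠ i in l, 0 < c i)
    (hc0 : Tendsto c l (𝓝 c₀)) (hX : 0 < X) :
    Tendsto (fun i => (expMeasure 1).real {y | X * y ≤ ε i * (W * y + c i)} / ε i) l
      (𝓝 (c₀ * X⁻¹)) := by
  have hk : Tendsto (fun i => c i / (X - ε i * W)) l (𝓝 (c₀ * X⁻¹)) := by
    convert! hc0.div ((hε0.mul_const W).const_sub X) (by simpa using hX.ne') using 2
    simp [div_eq_mul_inv]
  -- `k / (1 + ε * k) ≤ (1 - exp (-(ε * k))) / ε ≤ k` with `k = c / (X - ε * W)`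
  have hlow : Tendsto (fun i => c i / (X - ε i * W) / (1 + ε i * (c i / (X - ε i * W)))) l
      (𝓝 (c₀ * X⁻¹)) := by
    convert! hk.div ((hε0.mul hk).const_add 1) (by simp) using 2
    simp
  have hlt : ∀ᶠ i in l, ε i * W < X :=
    (hε0.mul_const W).eventually_lt_const (by simpa using hX)
  refine tendsto_of_tendsto_of_tendsto_of_le_of_le' hlow hk ?_ ?_
  · filter_upwards [hε, hc, hlt] with i h1 h2 h3
    have h4 : 0 < c i / (X - ε i * W) := div_pos h2 (sub_pos.2 h3)
    rw [expMeasure_one_section_eq h1 h2 h3, Real.exp_neg]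
    generalize c i / (X - ε i * W) = k at *
    have h5 : 0 < ε i * k := mul_pos h1 h4
    have h6 := Real.add_one_le_exp (ε i * k)
    have h7 : (Real.exp (ε i * k))⁻¹ ≤ (1 + ε i * k)⁻¹ :=
      inv_anti₀ (by positivity) (by linarith)
    rw [le_div_iff₀ h1]
    refine le_trans (le_of_eq ?_) (sub_le_sub_left h7 1)
    field_simp
    ring
  · filter_upwards [hε, hc, hlt] with i h1 h2 h3
    rw [expMeasure_one_section_eq h1 h2 h3, div_le_iff₀ h1]
    have := Real.add_one_le_exp (-(ε i * (c i / (X - ε i * W))))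
    linarith

/-- With `n + 2 ≥ 2` antennas, the outage probability is asymptotic to `ε` times
`c₀ * 𝔼[1 / X] = c₀ / (n + 1)`: only the destination noise, which is the term in `c`, survives. -/
lemma tendsto_normalizedOutage_div {n : ℕ} {ρI : ℝ} (hρI : 0 ≤ ρI) {ι : Type*} {l : Filter ι}
    [l.IsCountablyGenerated] {ε c : ι → ℝ} {c₀ : ℝ}
    (hε : ∀ᶠ i in l, 0 < ε i) (hε0 : Tendsto ε l (𝓝 0)) (hc : ∀ᶠ i in l, 0 < c i)
    (hc0 : Tendsto c l (𝓝 c₀)) :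
    Tendsto (fun i => normalizedOutage (n + 2) ρI (ε i) (c i) / ε i) l (𝓝 (c₀ / (n + 1))) := by
  set 𝓧 := Measure.pi fun _ : Fin (n + 2) => expMeasure 1
  have hlim : ∫ q, c₀ * (∑ i, q.1 i)⁻¹ ∂(𝓧.prod (expMeasure 1)) = c₀ / (n + 1) := by
    rw [integral_const_mul, integral_fun_fst (fun x : Fin (n + 2) → ℝ => (∑ i, x i)⁻¹),
      integral_inv_sum]
    simp [div_eq_mul_inv]
  have hpos : ∀ᵐ q ∂(𝓧.prod (expMeasure 1)), 0 < ∑ i, q.1 i ∧ 0 < q.2 := by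
    have h1 := Measure.quasiMeasurePreserving_fst (μ := 𝓧) (ν := expMeasure 1) |>.ae
      (ae_sum_pos (by omega))
    have h2 := Measure.quasiMeasurePreserving_snd (μ := 𝓧) (ν := expMeasure 1) |>.ae
      ae_pos_expMeasure_one
    exact h1.and h2
  have hint : Integrable (fun q : (Fin (n + 2) → ℝ) × ℝ =>
      2 * (ρI * q.2 + 1 + (c₀ + 1)) * (∑ i, q.1 i)⁻¹) (𝓧.prod (expMeasure 1)) := by
    have h : Integrable (fun z => 2 * (ρI * z + 1 + (c₀ + 1))) (expMeasure 1) :=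
      (((integrable_id_expMeasure_one.const_mul ρI).add (integrable_const _)).add
        (integrable_const _)).const_mul 2
    exact ((integrable_inv_sum n).mul_prod h).congr (ae_of_all _ fun q => mul_comm _ _)
  have key := tendsto_integral_filter_of_dominated_convergence (μ := 𝓧.prod (expMeasure 1)) (l := l)
    (F := fun i q => (expMeasure 1).real
      {y | (∑ j, q.1 j) * y ≤ ε i * ((ρI * q.2 + 1) * y + c i)} / ε i)
    (f := fun q => c₀ * (∑ j, q.1 j)⁻¹) _ ?_ ?_ hint ?_
  · rw [hlim] at key
    refine key.congr fun i => ?_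
    rw [integral_div, normalizedOutage_eq_integral]
  · refine Eventually.of_forall fun i => Measurable.aestronglyMeasurable ?_
    have hs : MeasurableSet {p : ((Fin (n + 2) → ℝ) × ℝ) × ℝ |
        (∑ i, p.1.1 i) * p.2 ≤ ε i * ((ρI * p.1.2 + 1) * p.2 + c i)} :=
      measurableSet_le (by fun_prop) (by fun_prop)
    exact (measurable_measure_prodMk_left hs).ennreal_toReal.div_const _
  · filter_upwards [hε, hc, hc0.eventually_le_const (lt_add_one c₀)] with i h1 h2 h3
    filter_upwards [hpos] with q hq
    rw [Real.norm_of_nonneg (by positivity)]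
    refine (expMeasure_one_section_div_le h1 h2 hq.1
      (by have := mul_nonneg hρI hq.2.le; linarith)).trans ?_
    gcongr
    exact inv_nonneg.2 hq.1.le
  · filter_upwards [hpos] with q hq
    exact tendsto_expMeasure_one_section_div hε hε0 hc hc0 hq.1

/-! ### The inverse exponential moment of an exponential variable -/

/-- The integral is the derivative at `1` of the Gamma integral. -/
lemma integral_exp_neg_mul_log :
    ∫ x in Set.Ioi (0 : ℝ), Real.exp (-x) * Real.log x = -Real.eulerMascheroniConstant := by
  have h1 := Complex.hasDerivAt_GammaIntegral (s := 1) (by simp)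
  have h2 : HasDerivAt Complex.GammaIntegral (-Real.eulerMascheroniConstant : ℂ) 1 := by
    refine Complex.hasDerivAt_Gamma_one.congr_of_eventuallyEq ?_
    filter_upwards [(isOpen_lt continuous_const Complex.continuous_re).mem_nhds
      (show (0 : ℝ) < (1 : ℂ).re by simp)] with s hs using (Complex.Gamma_eq_integral hs).symm
  have h := h1.unique h2
  have h3 : ∀ t : ℝ, (t : ℂ) ^ ((1 : ℂ) - 1) * (Real.log t * Real.exp (-t))
      = ((Real.exp (-t) * Real.log t : ℝ) : ℂ) := by
    intro t
    rw [sub_self, Complex.cpow_zero]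
    push_cast
    ring
  simp_rw [h3] at h
  rw [integral_complex_ofReal] at h
  exact_mod_cast h

lemma integrableOn_exp_neg_mul_log :
    IntegrableOn (fun x => Real.exp (-x) * Real.log x) (Set.Ioi 0) := by
  -- a non-integrable function would have integral `0`, but `γ > 1 / 2`
  refine Integrable.of_integral_ne_zero ?_
  rw [integral_exp_neg_mul_log, neg_ne_zero]
  have := Real.one_half_lt_eulerMascheroniConstant
  linarith

lemma integrableOn_exp_neg_div {a : ℝ} (ha : 0 < a) :
    IntegrableOn (fun x => Real.exp (-x) / x) (Set.Ioi a) := by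
  refine ((integrableOn_exp_neg_Ioi a).div_const a).mono'
    (Measurable.aestronglyMeasurable (by fun_prop)) ?_
  refine (ae_restrict_iff' measurableSet_Ioi).2 (ae_of_all _ fun x (hx : a < x) => ?_)
  have hx0 := ha.trans hx
  rw [Real.norm_of_nonneg (by positivity)]
  gcongr

/-- The exponential integral `E₁ a = ∫ x > a, exp (-x) / x`, meaningful for `0 < a`. -/
noncomputable def expIntegral (a : ℝ) : ℝ := ∫ x in Set.Ioi a, Real.exp (-x) / x

lemma tendsto_exp_neg_mul_log_atTop :
    Tendsto (fun x => Real.exp (-x) * Real.log x) atTop (𝓝 0) := by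
  have h := Real.tendsto_pow_mul_exp_neg_atTop_nhds_zero 1
  refine tendsto_of_tendsto_of_tendsto_of_le_of_le' tendsto_const_nhds h ?_ ?_
  · filter_upwards [eventually_ge_atTop 1] with x hx
    exact mul_nonneg (Real.exp_pos _).le (Real.log_nonneg hx)
  · filter_upwards [eventually_ge_atTop 1] with x hx
    rw [pow_one, mul_comm]
    gcongr
    exact Real.log_le_self (by linarith)

/-- Integration by parts. -/
lemma expIntegral_eq {a : ℝ} (ha : 0 < a) :
    expIntegral a = -(Real.exp (-a) * Real.log a)
      + ∫ x in Set.Ioi a, Real.exp (-x) * Real.log x := by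
  have hi := integrableOn_exp_neg_mul_log.mono_set (Set.Ioi_subset_Ioi ha.le)
  have h := integral_Ioi_of_hasDerivAt_of_tendsto' (a := a)
    (f := fun x => Real.exp (-x) * Real.log x)
    (f' := fun x => Real.exp (-x) / x - Real.exp (-x) * Real.log x) (m := 0) ?_
    ((integrableOn_exp_neg_div ha).sub hi) tendsto_exp_neg_mul_log_atTop
  · rw [integral_sub (integrableOn_exp_neg_div ha) hi] at h
    rw [expIntegral]
    linarith
  · intro x (hx : a ≤ x)
    refine ((hasDerivAt_neg x).exp.mul (Real.hasDerivAt_log (ha.trans_le hx).ne')).congr_deriv ?_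
    ring

lemma tendsto_one_sub_exp_neg_mul_log :
    Tendsto (fun a : ℝ => (1 - Real.exp (-a)) * Real.log a) (𝓝[>] 0) (𝓝 0) := by
  have h : Tendsto (fun a : ℝ => ‖Real.log a * a‖) (𝓝[>] 0) (𝓝 0) := by
    simpa using (tendsto_log_mul_rpow_nhdsGT_zero one_pos).norm
  refine squeeze_zero_norm' ?_ h
  filter_upwards [self_mem_nhdsWithin] with a (ha : 0 < a)
  have h1 := Real.add_one_le_exp (-a)
  have h2 : Real.exp (-a) ≤ 1 := Real.exp_le_one_iff.2 (by linarith)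
  rw [mul_comm, norm_mul, norm_mul]
  refine mul_le_mul_of_nonneg_left ?_ (norm_nonneg _)
  rw [Real.norm_of_nonneg (by linarith), Real.norm_of_nonneg ha.le]
  linarith

lemma tendsto_expIntegral_add_log :
    Tendsto (fun a => expIntegral a + Real.log a) (𝓝[>] 0)
      (𝓝 (-Real.eulerMascheroniConstant)) := by
  have h2 : Tendsto (fun a : ℝ => ∫ x in Set.Ioi a, Real.exp (-x) * Real.log x) (𝓝[>] 0)
      (𝓝 (-Real.eulerMascheroniConstant)) := by
    rw [← integral_exp_neg_mul_log]
    exact integrableOn_exp_neg_mul_log.continuousWithinAt_Ici_primitive_Ioi.tendsto.mono_left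
      (nhdsWithin_mono _ Set.Ioi_subset_Ici_self)
  have h := tendsto_one_sub_exp_neg_mul_log.add h2
  rw [zero_add] at h
  refine h.congr' ?_
  filter_upwards [self_mem_nhdsWithin] with a ha
  rw [expIntegral_eq ha]
  ring

lemma hasDerivAt_expIntegral {a : ℝ} (ha : 0 < a) :
    HasDerivAt expIntegral (-(Real.exp (-a) / a)) a := by
  have hb : 0 < a / 2 := by positivity
  have hc : ContinuousOn (fun x : ℝ => Real.exp (-x) / x) (Set.Ioi 0) :=
    ContinuousOn.div (by fun_prop) continuousOn_id fun x hx => ne_of_gt hx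
  have hd : HasDerivAt (fun u => ∫ x in (a / 2)..u, Real.exp (-x) / x) (Real.exp (-a) / a) a := by
    refine intervalIntegral.integral_hasDerivAt_right ?_
      (hc.stronglyMeasurableAtFilter isOpen_Ioi a ha) (hc.continuousAt (Ioi_mem_nhds ha))
    refine (hc.mono ?_).intervalIntegrable
    rw [Set.uIcc_of_le (by linarith)]
    exact fun x hx => hb.trans_le hx.1
  refine (hd.const_sub (expIntegral (a / 2))).congr_of_eventuallyEq ?_
  filter_upwards [Ioi_mem_nhds (half_lt_self ha)] with u (hu : a / 2 < u)
  rw [← intervalIntegral.integral_Ioi_sub_Ioi (integrableOn_exp_neg_div hb) hu.le, expIntegral,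
    expIntegral, sub_sub_cancel]

lemma expIntegral_nonneg {a : ℝ} (ha : 0 < a) : 0 ≤ expIntegral a :=
  setIntegral_nonneg measurableSet_Ioi fun x (hx : a < x) =>
    div_nonneg (Real.exp_pos _).le (ha.trans hx).le

lemma expIntegral_le_inv {a : ℝ} (ha : 0 < a) : expIntegral a ≤ a⁻¹ := by
  calc expIntegral a ≤ ∫ x in Set.Ioi a, Real.exp (-x) / a := by
        refine setIntegral_mono_on (integrableOn_exp_neg_div ha)
          ((integrableOn_exp_neg_Ioi a).div_const a) measurableSet_Ioi fun x (hx : a < x) => ?_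
        gcongr
    _ = Real.exp (-a) / a := by rw [integral_div, integral_exp_neg_Ioi]
    _ ≤ a⁻¹ := by
        rw [← one_div]
        gcongr
        exact Real.exp_le_one_iff.2 (by linarith)

lemma inv_one_add_le_one_sub_exp {u : ℝ} (hu : 0 < u) : (1 + u)⁻¹ ≤ 1 - Real.exp (-u⁻¹) := by
  have h := Real.add_one_le_exp u⁻¹
  have h' : (Real.exp u⁻¹)⁻¹ ≤ (u⁻¹ + 1)⁻¹ := inv_anti₀ (by positivity) h
  rw [Real.exp_neg]
  refine le_trans (le_of_eq ?_) (sub_le_sub_left h' 1)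
  field_simp
  ring

/-- A primitive on `(0, ∞)` of `1 - exp (-1 / u) - 1 / (1 + u)`, extended by its limit `0` at `0`
(there the formula would evaluate the divergent integral `E₁ 0`, since `0⁻¹ = 0`). -/
noncomputable def regularizedPrimitive : ℝ → ℝ :=
  (Set.Ioi 0).indicator fun u =>
    u * (1 - Real.exp (-u⁻¹)) + expIntegral u⁻¹ - Real.log (1 + u)

lemma hasDerivAt_regularizedPrimitive {u : ℝ} (hu : 0 < u) :
    HasDerivAt regularizedPrimitive (1 - Real.exp (-u⁻¹) - (1 + u)⁻¹) u := by
  have h1 := (hasDerivAt_id u).mul ((hasDerivAt_inv hu.ne').neg.exp.const_sub 1)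
  have h2 := (hasDerivAt_expIntegral (inv_pos.2 hu)).comp u (hasDerivAt_inv hu.ne')
  have h3 := ((hasDerivAt_id u).const_add 1).log (by simp; positivity)
  refine HasDerivAt.congr_of_eventuallyEq (((h1.add h2).sub h3).congr_deriv ?_) ?_
  · simp
    field_simp
    ring
  · filter_upwards [Ioi_mem_nhds hu] with v hv
    simp [regularizedPrimitive, Set.indicator_of_mem hv]

lemma continuousWithinAt_regularizedPrimitive :
    ContinuousWithinAt regularizedPrimitive (Set.Ici 0) 0 := by
  rw [← continuousWithinAt_Ioi_iff_Ici, ContinuousWithinAt]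
  have h0 : regularizedPrimitive 0 = 0 := by simp [regularizedPrimitive]
  rw [h0]
  have hb : Tendsto (fun u : ℝ => 2 * u + Real.log (1 + u)) (𝓝[>] 0) (𝓝 0) := by
    have : ContinuousAt (fun u : ℝ => 2 * u + Real.log (1 + u)) 0 :=
      ContinuousAt.add (by fun_prop) (ContinuousAt.log (by fun_prop) (by simp))
    simpa using this.tendsto.mono_left nhdsWithin_le_nhds
  refine squeeze_zero_norm' ?_ hb
  filter_upwards [self_mem_nhdsWithin] with u hu
  have hu' : 0 < u := hu
  rw [regularizedPrimitive, Set.indicator_of_mem hu, Real.norm_eq_abs, abs_le]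
  have h1 := expIntegral_nonneg (inv_pos.2 hu')
  have h2 := expIntegral_le_inv (inv_pos.2 hu')
  rw [inv_inv] at h2
  have h3 : 0 ≤ Real.log (1 + u) := Real.log_nonneg (by linarith)
  have h4 := Real.exp_pos (-u⁻¹)
  have h5 : Real.exp (-u⁻¹) ≤ 1 := Real.exp_le_one_iff.2 (by simpa using hu'.le)
  constructor <;> nlinarith

lemma tendsto_regularizedPrimitive_atTop :
    Tendsto regularizedPrimitive atTop (𝓝 (1 - Real.eulerMascheroniConstant)) := by
  have h1 : Tendsto (fun u : ℝ => u * (1 - Real.exp (-u⁻¹))) atTop (𝓝 1) := by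
    have hlow : Tendsto (fun u : ℝ => u * (1 + u)⁻¹) atTop (𝓝 1) := by
      have h : Tendsto (fun u : ℝ => 1 - (1 + u)⁻¹) atTop (𝓝 (1 - 0)) :=
        (tendsto_inv_atTop_zero.comp (tendsto_atTop_add_const_left _ 1 tendsto_id)).const_sub 1
      rw [sub_zero] at h
      refine h.congr' ?_
      filter_upwards [eventually_gt_atTop 0] with u hu
      field_simp
      ring
    refine tendsto_of_tendsto_of_tendsto_of_le_of_le' hlow tendsto_const_nhds ?_ ?_
    · filter_upwards [eventually_gt_atTop 0] with u hu
      exact mul_le_mul_of_nonneg_left (inv_one_add_le_one_sub_exp hu) hu.le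
    · filter_upwards [eventually_gt_atTop 0] with u hu
      have := Real.add_one_le_exp (-u⁻¹)
      calc u * (1 - Real.exp (-u⁻¹)) ≤ u * u⁻¹ := by gcongr; linarith
        _ = 1 := mul_inv_cancel₀ hu.ne'
  have h2 := tendsto_expIntegral_add_log.comp tendsto_inv_atTop_nhdsGT_zero
  have h3 : Tendsto (fun u : ℝ => Real.log (1 + u⁻¹)) atTop (𝓝 0) := by
    have := (tendsto_inv_atTop_zero (𝕜 := ℝ)).const_add 1 |>.log (by simp)
    simpa using this
  have h := (h1.add h2).sub h3
  rw [sub_zero, ← sub_eq_add_neg] at h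
  refine h.congr' ?_
  filter_upwards [eventually_gt_atTop 0] with u hu
  rw [regularizedPrimitive, Set.indicator_of_mem (Set.mem_Ioi.2 hu)]
  have : Real.log (1 + u) = Real.log u + Real.log (1 + u⁻¹) := by
    rw [← Real.log_mul hu.ne' (by positivity)]
    congr 1; field_simp; ring
  simp only [Function.comp_apply, Real.log_inv, this]
  ring

/-- The integrand is nonnegative, so the existence of a limit of the primitive at infinity gives
integrability. -/
lemma integrableOn_regularized :
    IntegrableOn (fun u => 1 - Real.exp (-u⁻¹) - (1 + u)⁻¹) (Set.Ioi 0) :=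
  integrableOn_Ioi_deriv_of_nonneg continuousWithinAt_regularizedPrimitive
    (fun _ hu => hasDerivAt_regularizedPrimitive hu)
    (fun _ hu => sub_nonneg.2 (inv_one_add_le_one_sub_exp hu)) tendsto_regularizedPrimitive_atTop

lemma norm_exp_neg_mul_regularized_le {δ u : ℝ} (hδ : 0 < δ) (hu : 0 < u) :
    ‖Real.exp (-(δ * u)) * (1 - Real.exp (-u⁻¹) - (1 + u)⁻¹)‖
      ≤ 1 - Real.exp (-u⁻¹) - (1 + u)⁻¹ := by
  have h := sub_nonneg.2 (inv_one_add_le_one_sub_exp hu)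
  rw [Real.norm_of_nonneg (by positivity)]
  exact mul_le_of_le_one_left h (Real.exp_le_one_iff.2 (by have := mul_pos hδ hu; linarith))

lemma integrableOn_exp_neg_mul_regularized {δ : ℝ} (hδ : 0 < δ) :
    IntegrableOn (fun u => Real.exp (-(δ * u)) * (1 - Real.exp (-u⁻¹) - (1 + u)⁻¹))
      (Set.Ioi 0) :=
  integrableOn_regularized.mono' (Measurable.aestronglyMeasurable (by fun_prop))
    ((ae_restrict_iff' measurableSet_Ioi).2
      (ae_of_all _ fun _ hu => norm_exp_neg_mul_regularized_le hδ hu))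

lemma integral_regularized :
    ∫ u in Set.Ioi (0 : ℝ), (1 - Real.exp (-u⁻¹) - (1 + u)⁻¹)
      = 1 - Real.eulerMascheroniConstant := by
  rw [integral_Ioi_of_hasDerivAt_of_nonneg continuousWithinAt_regularizedPrimitive
    (fun _ hu => hasDerivAt_regularizedPrimitive hu)
    (fun _ hu => sub_nonneg.2 (inv_one_add_le_one_sub_exp hu)) tendsto_regularizedPrimitive_atTop]
  simp [regularizedPrimitive]

lemma integrableOn_exp_neg_div_add {δ : ℝ} (hδ : 0 < δ) :
    IntegrableOn (fun y => Real.exp (-y) / (δ + y)) (Set.Ioi 0) := by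
  refine ((integrableOn_exp_neg_Ioi 0).div_const δ).mono'
    (Measurable.aestronglyMeasurable (by fun_prop)) ?_
  refine (ae_restrict_iff' measurableSet_Ioi).2 (ae_of_all _ fun x (hx : 0 < x) => ?_)
  rw [Real.norm_of_nonneg (by positivity)]
  gcongr
  linarith

lemma integral_exp_neg_div_add (δ : ℝ) :
    ∫ y in Set.Ioi 0, Real.exp (-y) / (δ + y) = Real.exp δ * expIntegral δ := by
  have h := (measurePreserving_add_left volume δ).setIntegral_preimage_emb
    (measurableEmbedding_addLeft δ) (fun x => Real.exp (-x) / x) (Set.Ioi δ)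
  rw [expIntegral, ← h, ← integral_const_mul]
  simp only [Set.preimage_const_add_Ioi, sub_self]
  congr 1
  ext y
  rw [mul_div_assoc', ← Real.exp_add]
  congr 2
  ring

lemma tendsto_integral_exp_neg_div_add :
    Tendsto (fun δ => (∫ y in Set.Ioi 0, Real.exp (-y) / (δ + y)) + Real.log δ) (𝓝[>] 0)
      (𝓝 (-Real.eulerMascheroniConstant)) := by
  have he : Tendsto (fun δ : ℝ => Real.exp δ) (𝓝[>] 0) (𝓝 1) := by
    simpa using (Real.continuous_exp.tendsto 0).mono_left nhdsWithin_le_nhds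
  have h := he.mul (tendsto_expIntegral_add_log.sub tendsto_one_sub_exp_neg_mul_log)
  rw [sub_zero, one_mul] at h
  refine h.congr fun δ => ?_
  have h1 : Real.exp δ * Real.exp (-δ) = 1 := by rw [← Real.exp_add]; simp
  rw [integral_exp_neg_div_add]
  linear_combination Real.log δ * h1

lemma integrable_exp_neg_div {δ : ℝ} (hδ : 0 ≤ δ) :
    Integrable (fun y => Real.exp (-(δ / y))) (expMeasure 1) := by
  refine Integrable.of_bound (Measurable.aestronglyMeasurable (by fun_prop)) 1 ?_
  filter_upwards [ae_pos_expMeasure_one] with y hy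
  rw [Real.norm_of_nonneg (Real.exp_pos _).le, Real.exp_le_one_iff, neg_nonpos]
  positivity

/-- After the substitution `y = δ * u`, the integrand is `exp (-(δ * u)) * (1 - exp (-1 / u))`, whose
second factor is only just not integrable. Its divergent part `1 / (1 + u)` is split off, and the
substitution is undone in that part. -/
lemma one_sub_integral_exp_neg_div {δ : ℝ} (hδ : 0 < δ) :
    (1 - ∫ y, Real.exp (-(δ / y)) ∂expMeasure 1) / δ
      = (∫ u in Set.Ioi 0, Real.exp (-(δ * u)) * (1 - Real.exp (-u⁻¹) - (1 + u)⁻¹))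
        + ∫ y in Set.Ioi 0, Real.exp (-y) / (δ + y) := by
  have h1 : 1 - ∫ y, Real.exp (-(δ / y)) ∂expMeasure 1
      = ∫ y in Set.Ioi 0, Real.exp (-y) * (1 - Real.exp (-(δ / y))) := by
    have h := integral_sub (integrable_const (1 : ℝ)) (integrable_exp_neg_div hδ.le)
    rw [integral_const, probReal_univ, one_smul] at h
    rw [← h, integral_expMeasure_one]
    simp_rw [smul_eq_mul]
  have h2 := integral_comp_mul_left_Ioi
    (fun y => Real.exp (-y) * (1 - Real.exp (-(δ / y)))) 0 hδ
  have h3 := integral_comp_mul_left_Ioi' (fun y => Real.exp (-y) / (δ + y)) 0 hδ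
  rw [mul_zero, ← h1, smul_eq_mul, inv_mul_eq_div] at h2
  rw [mul_zero, smul_eq_mul, ← integral_const_mul] at h3
  rw [← h2, ← h3, ← integral_add (integrableOn_exp_neg_mul_regularized hδ)]
  · refine setIntegral_congr_fun measurableSet_Ioi fun u (hu : 0 < u) => ?_
    have e1 : δ / (δ * u) = u⁻¹ := by field_simp
    have e2 : δ * (Real.exp (-(δ * u)) / (δ + δ * u)) = Real.exp (-(δ * u)) * (1 + u)⁻¹ := by
      field_simp
    simp only [e1, e2]
    ring
  · refine Integrable.const_mul ?_ δ
    have := (integrableOn_Ioi_comp_mul_left_iff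
      (fun y => Real.exp (-y) / (δ + y)) 0 hδ).2 (by simpa using integrableOn_exp_neg_div_add hδ)
    exact this

/-- The expansion `𝔼[exp (-δ / Y)] = 1 + δ * (log δ + 2 * γ - 1) + o(δ)` for an exponential variable
`Y` (that is, of `2 * √δ * K₁ (2 * √δ)` with the Bessel function `K₁`). -/
lemma tendsto_one_sub_integral_exp_neg_div :
    Tendsto (fun δ => (1 - ∫ y, Real.exp (-(δ / y)) ∂expMeasure 1) / δ + Real.log δ) (𝓝[>] 0)
      (𝓝 (1 - 2 * Real.eulerMascheroniConstant)) := by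
  have h1 : Tendsto (fun δ : ℝ => ∫ u in Set.Ioi 0,
      Real.exp (-(δ * u)) * (1 - Real.exp (-u⁻¹) - (1 + u)⁻¹)) (𝓝[>] 0)
      (𝓝 (1 - Real.eulerMascheroniConstant)) := by
    rw [← integral_regularized]
    refine tendsto_integral_filter_of_dominated_convergence _ ?_ ?_ integrableOn_regularized ?_
    · exact Eventually.of_forall fun δ => by fun_prop
    · filter_upwards [self_mem_nhdsWithin] with δ (hδ : 0 < δ)
      exact (ae_restrict_iff' measurableSet_Ioi).2
        (ae_of_all _ fun u hu => norm_exp_neg_mul_regularized_le hδ hu)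
    · refine ae_of_all _ fun u => ?_
      have : Continuous fun δ : ℝ =>
        Real.exp (-(δ * u)) * (1 - Real.exp (-u⁻¹) - (1 + u)⁻¹) := by fun_prop
      simpa using this.tendsto 0 |>.mono_left nhdsWithin_le_nhds
  have h := h1.add tendsto_integral_exp_neg_div_add
  rw [show 1 - 2 * Real.eulerMascheroniConstant
    = 1 - Real.eulerMascheroniConstant + -Real.eulerMascheroniConstant by ring]
  refine h.congr' ?_
  filter_upwards [self_mem_nhdsWithin] with δ hδ
  rw [one_sub_integral_exp_neg_div hδ]
  ring

/-! ### A single transmit antenna, and the passage to high SNR -/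

lemma measureReal_prod_eq_integral_symm {α β : Type*} [MeasurableSpace α] [MeasurableSpace β]
    (μ : Measure α) (ν : Measure β) [IsFiniteMeasure μ] [IsFiniteMeasure ν] {s : Set (α × β)}
    (hs : MeasurableSet s) :
    (μ.prod ν).real s = ∫ y, μ.real ((fun x => (x, y)) ⁻¹' s) ∂ν := by
  rw [measureReal_def, Measure.prod_apply_symm hs, ← integral_toReal
    (measurable_measure_prodMk_right hs).aemeasurable (ae_of_all _ fun x => measure_lt_top _ _)]
  rfl

/-- With one antenna, conditioning on the second-hop and interference powers leaves an exponential
tail which factorizes. -/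
lemma normalizedOutage_one {ρI ε c : ℝ} (hρI : 0 ≤ ρI) (hε : 0 < ε) (hc : 0 < c) :
    normalizedOutage 1 ρI ε c = 1 - Real.exp (-ε) * (1 + ε * ρI)⁻¹
      * ∫ y, Real.exp (-(ε * c / y)) ∂expMeasure 1 := by
  have hs : MeasurableSet {p : (Fin 1 → ℝ) × ℝ × ℝ |
      (∑ i, p.1 i) * p.2.1 ≤ ε * ((ρI * p.2.2 + 1) * p.2.1 + c)} :=
    measurableSet_le (by fun_prop) (by fun_prop)
  have hpos : ∀ᵐ q ∂((expMeasure 1).prod (expMeasure 1)), 0 < q.1 ∧ 0 < q.2 := by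
    have h1 := Measure.quasiMeasurePreserving_fst (μ := expMeasure 1) (ν := expMeasure 1) |>.ae
      ae_pos_expMeasure_one
    have h2 := Measure.quasiMeasurePreserving_snd (μ := expMeasure 1) (ν := expMeasure 1) |>.ae
      ae_pos_expMeasure_one
    exact h1.and h2
  have hsec : ∀ q : ℝ × ℝ, 0 < q.1 ∧ 0 < q.2 →
      (Measure.pi fun _ : Fin 1 => expMeasure 1).real
        {x | (∑ i, x i) * q.1 ≤ ε * ((ρI * q.2 + 1) * q.1 + c)}
      = 1 - Real.exp (-ε) * (Real.exp (-(ε * c / q.1)) * Real.exp (-(ε * ρI * q.2))) := by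
    rintro ⟨y, z⟩ ⟨hy : 0 < y, hz : 0 < z⟩
    have hmp := measurePreserving_eval (fun _ : Fin 1 => expMeasure 1) 0
    rw [← Real.exp_add, ← Real.exp_add,
      show -ε + (-(ε * c / y) + -(ε * ρI * z)) = -(ε * ((ρI * z + 1) + c / y)) by ring,
      ← measureReal_expMeasure_one_Iic (by positivity),
      ← hmp.measureReal_preimage measurableSet_Iic.nullMeasurableSet]
    congr 1
    ext x
    have e : ε * ((ρI * z + 1) + c / y) = ε * ((ρI * z + 1) * y + c) / y := by field_simp
    rw [Set.mem_ofPred_eq, Set.mem_preimage, Set.mem_Iic, e, le_div_iff₀ hy]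
    simp
  have hi2 : Integrable (fun z => Real.exp (-(ε * ρI * z))) (expMeasure 1) := by
    refine Integrable.of_integral_ne_zero ?_
    rw [integral_exp_neg_mul_expMeasure_one (by positivity)]
    positivity
  have h := integral_sub (integrable_const (1 : ℝ)) (((integrable_exp_neg_div (mul_pos hε hc).le).mul_prod hi2).const_mul (Real.exp (-ε)))
  rw [integral_const, probReal_univ, one_smul, integral_const_mul,
    integral_prod_mul (fun y => Real.exp (-(ε * c / y))) (fun z => Real.exp (-(ε * ρI * z))),
    integral_exp_neg_mul_expMeasure_one (by positivity)] at h
  rw [normalizedOutage, measureReal_prod_eq_integral_symm _ _ hs, mul_assoc,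
    mul_comm (1 + ε * ρI)⁻¹, ← h]
  refine integral_congr_ae ?_
  filter_upwards [hpos] with q hq using hsec q hq

lemma tendsto_exp_neg_mul_inv_mul_sub_div (ρI c₀ K : ℝ) :
    Tendsto (fun ε => (Real.exp (-ε) * (1 + ε * ρI)⁻¹ * (c₀ + K * ε) - c₀) / ε) (𝓝[>] 0)
      (𝓝 (K - c₀ * (1 + ρI))) := by
  have h1 : HasDerivAt (fun ε : ℝ => Real.exp (-ε)) (-1) 0 := by
    simpa using (hasDerivAt_neg (0 : ℝ)).exp
  have h2 : HasDerivAt (fun ε : ℝ => (1 + ε * ρI)⁻¹) (-ρI) 0 := by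
    convert! (((hasDerivAt_id (0 : ℝ)).mul_const ρI).const_add 1).inv (by simp) using 1
    simp
  have h3 : HasDerivAt (fun ε : ℝ => c₀ + K * ε) K 0 := by
    simpa using ((hasDerivAt_id (0 : ℝ)).const_mul K).const_add c₀
  have h := ((h1.mul h2).mul h3).tendsto_slope_zero_right
  have e : (-1 * (1 + 0 * ρI)⁻¹ + Real.exp (-0) * -ρI) * (c₀ + K * 0)
      + Real.exp (-0) * (1 + 0 * ρI)⁻¹ * K = K - c₀ * (1 + ρI) := by
    simp; ring
  simp only [Pi.mul_apply] at h
  rw [e] at h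
  refine h.congr fun ε => ?_
  simp [div_eq_inv_mul]

/-- The one-antenna expansion up to `o(ε)`. The correction `K * ε` to `c₀` is multiplied by a
logarithm and still does not contribute. -/
lemma tendsto_normalizedOutage_one_div {ρI c₀ K : ℝ} (hρI : 0 ≤ ρI) (hc₀ : 0 < c₀) (hK : 0 ≤ K) :
    Tendsto (fun ε => normalizedOutage 1 ρI ε (c₀ + K * ε) / ε
        - (c₀ * (-Real.log (c₀ * ε) + 1 - 2 * Real.eulerMascheroniConstant) + ρI + 1))
      (𝓝[>] 0) (𝓝 0) := by
  set J : ℝ → ℝ := fun δ => (1 - ∫ y, Real.exp (-(δ / y)) ∂expMeasure 1) / δ with hJ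
  have hid : Tendsto (fun ε : ℝ => ε) (𝓝[>] 0) (𝓝 0) := nhdsWithin_le_nhds
  have hc : Tendsto (fun ε : ℝ => c₀ + K * ε) (𝓝[>] 0) (𝓝 c₀) := by
    simpa using (hid.const_mul K).const_add c₀
  have hδ : Tendsto (fun ε : ℝ => ε * (c₀ + K * ε)) (𝓝[>] 0) (𝓝[>] 0) := by
    refine tendsto_nhdsWithin_iff.2 ⟨by simpa using hid.mul hc, ?_⟩
    filter_upwards [self_mem_nhdsWithin] with ε (hε : 0 < ε)
    exact Set.mem_Ioi.2 (by positivity)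
  have hJlim : Tendsto (fun ε => J (ε * (c₀ + K * ε)) + Real.log (ε * (c₀ + K * ε))) (𝓝[>] 0)
      (𝓝 (1 - 2 * Real.eulerMascheroniConstant)) :=
    tendsto_one_sub_integral_exp_neg_div.comp hδ
  -- `ε * J δ → 0` because `J δ` grows only logarithmically
  have hεJ : Tendsto (fun ε : ℝ => ε * J (ε * (c₀ + K * ε))) (𝓝[>] 0) (𝓝 0) := by
    have hlog : Tendsto (fun a : ℝ => Real.log a * a) (𝓝[>] 0) (𝓝 0) := by
      simpa using tendsto_log_mul_rpow_nhdsGT_zero one_pos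
    have h := (hid.mul hJlim).sub ((hlog.comp hδ).div hc hc₀.ne')
    rw [zero_mul, zero_div, sub_zero] at h
    refine h.congr' ?_
    filter_upwards [self_mem_nhdsWithin] with ε (hε : 0 < ε)
    have : 0 < c₀ + K * ε := by positivity
    simp only [Pi.div_apply, Function.comp_apply]
    field_simp
    ring
  have hlogc : Tendsto (fun ε : ℝ => Real.log (ε * (c₀ + K * ε)) - Real.log (c₀ * ε))
      (𝓝[>] 0) (𝓝 0) := by
    have h := (hc.log hc₀.ne').sub_const (Real.log c₀)
    rw [sub_self] at h
    refine h.congr' ?_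
    filter_upwards [self_mem_nhdsWithin] with ε (hε : 0 < ε)
    rw [Real.log_mul hε.ne' (by positivity), Real.log_mul hc₀.ne' hε.ne']
    ring
  have h := ((((tendsto_exp_neg_mul_inv_mul_sub_div ρI 1 0).neg.sub_const (1 + ρI)).add
    ((tendsto_exp_neg_mul_inv_mul_sub_div ρI c₀ K).mul hεJ)).add
      ((hJlim.sub_const (1 - 2 * Real.eulerMascheroniConstant)).const_mul c₀)).sub
        (hlogc.const_mul c₀)
  rw [show -(0 - 1 * (1 + ρI)) - (1 + ρI) + (K - c₀ * (1 + ρI)) * 0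
    + c₀ * (1 - 2 * Real.eulerMascheroniConstant - (1 - 2 * Real.eulerMascheroniConstant))
    - c₀ * 0 = 0 by ring] at h
  refine h.congr' ?_
  filter_upwards [self_mem_nhdsWithin] with ε (hε : 0 < ε)
  have hcε : 0 < c₀ + K * ε := by positivity
  have hL : ∫ y, Real.exp (-(ε * (c₀ + K * ε) / y)) ∂expMeasure 1
      = 1 - ε * (c₀ + K * ε) * J (ε * (c₀ + K * ε)) := by
    simp only [hJ]
    field_simp
    ring
  rw [normalizedOutage_one hρI hε hcε, hL]
  generalize J (ε * (c₀ + K * ε)) = j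
  generalize Real.exp (-ε) * (1 + ε * ρI)⁻¹ = g
  generalize Real.log (ε * (c₀ + K * ε)) = l₁
  field_simp
  ring

lemma digamma_one : digamma 1 = -Real.eulerMascheroniConstant := by
  rw [digamma, Complex.ofReal_one, Complex.digamma_one, Complex.neg_re, Complex.ofReal_re]

lemma digamma_two : digamma 2 = 1 - Real.eulerMascheroniConstant := by
  have h := Complex.digamma_apply_add_one 1 fun m h => by
    have := congrArg Complex.re h
    simp at this
    have hm : (0 : ℝ) ≤ m := m.cast_nonneg
    linarith
  rw [digamma, show ((2 : ℝ) : ℂ) = 1 + 1 by norm_num, h, Complex.digamma_one]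
  simp
  ring

/-- If `p ρ = (B ρ + o(1)) * γ / ρ` with `B` bounded below by a positive constant and growing at most
logarithmically, then `p` is asymptotic to its leading term and has diversity order one: in
`log p = log B + log γ - log ρ + o(1)`, the term `log B` is at most `log (log ρ) + O(1)`. -/
lemma highSNR_of_tendsto_sub {p B : ℝ → ℝ} {γ b : ℝ} (hγ : 0 < γ) (hb : 0 < b)
    (hB : ∀ᶠ ρ in atTop, b ≤ B ρ) (hBO : B =O[atTop] Real.log)
    (h : Tendsto (fun ρ => p ρ / (γ / ρ) - B ρ) atTop (𝓝 0)) :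
    ((fun ρ => p ρ - B ρ * (γ / ρ)) =o[atTop] fun ρ => 1 / ρ) ∧
    (p ~[atTop] fun ρ => B ρ * (γ / ρ)) ∧
    Tendsto (fun ρ => -Real.log (p ρ) / Real.log ρ) atTop (𝓝 1) := by
  have hsub : (fun ρ => p ρ - B ρ * (γ / ρ))
      =ᶠ[atTop] fun ρ => (p ρ / (γ / ρ) - B ρ) * (γ / ρ) := by
    filter_upwards [eventually_gt_atTop 0] with ρ hρ
    field_simp
  have h1 : (fun ρ => p ρ - B ρ * (γ / ρ)) =o[atTop] fun ρ => γ / ρ := by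
    refine IsLittleO.congr' ?_ hsub.symm (EventuallyEq.refl _ _)
    simpa using ((isLittleO_one_iff ℝ).2 h).mul_isBigO (isBigO_refl (fun ρ : ℝ => γ / ρ) atTop)
  have h2 : p ~[atTop] fun ρ => B ρ * (γ / ρ) := by
    refine h1.trans_isBigO (IsBigO.of_bound b⁻¹ ?_)
    filter_upwards [hB] with ρ hρ
    rw [norm_mul, ← mul_assoc]
    refine le_mul_of_one_le_left (norm_nonneg _) ?_
    rw [inv_mul_eq_div, one_le_div hb]
    exact hρ.trans (Real.le_norm_self _)
  refine ⟨?_, h2, ?_⟩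
  · refine h1.trans_isBigO (IsBigO.of_bound γ ?_)
    filter_upwards with ρ
    rw [div_eq_mul_one_div γ ρ, norm_mul, Real.norm_of_nonneg hγ.le]
  · have hlog := Real.tendsto_log_atTop
    have hinv : Tendsto (fun ρ => (Real.log ρ)⁻¹) atTop (𝓝 0) := hlog.inv_tendsto_atTop
    have hr : Tendsto (fun ρ => p ρ / (B ρ * (γ / ρ))) atTop (𝓝 1) := by
      refine (isEquivalent_iff_tendsto_one ?_).1 h2
      filter_upwards [hB, eventually_gt_atTop 0] with ρ h3 h4
      have := hb.trans_le h3
      positivity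
    have hlr := (hr.log one_ne_zero).mul hinv
    have hlB : Tendsto (fun ρ => Real.log (B ρ) * (Real.log ρ)⁻¹) atTop (𝓝 0) := by
      obtain ⟨C, hC, hBC⟩ := hBO.exists_pos
      have hlow := hinv.const_mul (Real.log b)
      have hloglog : Tendsto (fun ρ => Real.log (Real.log ρ) * (Real.log ρ)⁻¹) atTop (𝓝 0) := by
        simpa [div_eq_mul_inv, Function.comp_def] using
          (Real.isLittleO_log_id_atTop.tendsto_div_nhds_zero).comp hlog
      have hup := (hinv.const_mul (Real.log C)).add hloglog
      rw [mul_zero] at hlow hup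
      rw [add_zero] at hup
      refine tendsto_of_tendsto_of_tendsto_of_le_of_le' hlow hup ?_ ?_
      · filter_upwards [hB, hlog.eventually_gt_atTop 0] with ρ h3 h4
        gcongr
      · filter_upwards [hB, hBC.bound, hlog.eventually_gt_atTop 0] with ρ h3 h4 h5
        rw [← add_mul, ← Real.log_mul hC.ne' h5.ne']
        have h6 := (Real.le_norm_self _).trans h4
        rw [Real.norm_of_nonneg h5.le] at h6
        have h7 := hb.trans_le h3
        gcongr
    have hlim := ((hlr.add hlB).add (hinv.const_mul (Real.log γ))).const_sub 1
    rw [Real.log_one, zero_mul, mul_zero, add_zero, add_zero, sub_zero] at hlim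
    refine hlim.congr' ?_
    filter_upwards [hB, eventually_gt_atTop 0, hlog.eventually_gt_atTop 0,
      hr.eventually (lt_mem_nhds one_pos)] with ρ h3 h4 h5 h6
    have h7 := hb.trans_le h3
    have h8 : 0 < B ρ * (γ / ρ) := by positivity
    have h9 : 0 < p ρ := by
      by_contra hp
      exact absurd h6 (not_lt.2 (div_nonpos_of_nonpos_of_nonneg (not_lt.1 hp) h8.le))
    rw [Real.log_div h9.ne' h8.ne', Real.log_mul h7.ne' (by positivity),
      Real.log_div hγ.ne' h4.ne']
    field_simp
    ring

lemma outage_asymptotics (N : ℕ) (hN : 1 ≤ N) {μ ρI γth : ℝ} (hμ : 0 < μ) (hρI : 0 ≤ ρI)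
    (hγ : 0 < γth) :
    ((fun ρ => normalizedOutage N ρI (γth / ρ) ((N * ρ + ρI + 1) / (μ * ρ))
        - highSNRApprox N μ ρI γth ρ) =o[atTop] fun ρ => 1 / ρ) ∧
    ((fun ρ => normalizedOutage N ρI (γth / ρ) ((N * ρ + ρI + 1) / (μ * ρ)))
      ~[atTop] fun ρ => highSNRApprox N μ ρI γth ρ) ∧
    Tendsto (fun ρ => -Real.log (normalizedOutage N ρI (γth / ρ)
      ((N * ρ + ρI + 1) / (μ * ρ))) / Real.log ρ) atTop (𝓝 1) := by
  have hε0 : Tendsto (fun ρ : ℝ => γth / ρ) atTop (𝓝 0) := tendsto_const_nhds.div_atTop tendsto_id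
  have hεpos : ∀ᶠ ρ : ℝ in atTop, 0 < γth / ρ := by
    filter_upwards [eventually_gt_atTop 0] with ρ hρ using div_pos hγ hρ
  have hε : Tendsto (fun ρ : ℝ => γth / ρ) atTop (𝓝[>] 0) :=
    tendsto_nhdsWithin_iff.2 ⟨hε0, hεpos⟩
  -- the destination noise coefficient of the normalized outage event, as a function of `ε = γth / ρ`
  have hceq : ∀ᶠ ρ : ℝ in atTop, (N * ρ + ρI + 1) / (μ * ρ)
      = N / μ + (ρI + 1) / (μ * γth) * (γth / ρ) := by
    filter_upwards [eventually_gt_atTop 0] with ρ hρ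
    field_simp
    ring
  rcases hN.eq_or_lt with rfl | hN2
  · simp only [highSNRApprox, if_true]
    have hBtop : Tendsto (fun ρ => 1 / μ * (Real.log (μ * ρ / γth) + digamma 1 + digamma 2)
        + ρI + 1) atTop atTop := by
      have h1 : Tendsto (fun ρ : ℝ => μ * ρ / γth) atTop atTop :=
        (tendsto_id.const_mul_atTop hμ).atTop_div_const hγ
      refine tendsto_atTop_add_const_right _ _ (tendsto_atTop_add_const_right _ _ ?_)
      refine Tendsto.const_mul_atTop (by positivity) ?_
      exact tendsto_atTop_add_const_right _ _
        (tendsto_atTop_add_const_right _ _ (Real.tendsto_log_atTop.comp h1))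
    refine highSNR_of_tendsto_sub hγ one_pos (hBtop.eventually_ge_atTop 1) ?_ ?_
    · have hO : ∀ k : ℝ, (fun _ : ℝ => k) =O[atTop] Real.log := fun k =>
        (isLittleO_const_left.2 (.inr (tendsto_norm_atTop_atTop.comp
          Real.tendsto_log_atTop))).isBigO
      refine (((IsBigO.const_mul_left ?_ _).add (hO ρI))).add (hO 1)
      refine IsBigO.add (IsBigO.add ?_ (hO _)) (hO _)
      refine ((isBigO_refl Real.log atTop).add (hO (Real.log (μ / γth)))).congr' ?_ .rfl
      filter_upwards [eventually_gt_atTop 0] with ρ hρ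
      rw [mul_div_right_comm, Real.log_mul (by positivity) hρ.ne', add_comm]
    · refine ((tendsto_normalizedOutage_one_div hρI (inv_pos.2 hμ)
        (K := (ρI + 1) / (μ * γth)) (by positivity)).comp hε).congr' ?_
      filter_upwards [hceq, eventually_gt_atTop 0] with ρ h1 hρ
      have h2 : Real.log (μ * ρ / γth) = -Real.log (μ⁻¹ * (γth / ρ)) := by
        rw [← Real.log_inv]
        congr 1
        field_simp
      rw [h1, digamma_one, digamma_two, h2, Function.comp_apply, Nat.cast_one, one_div]
      ring
  · obtain ⟨n, rfl⟩ := Nat.exists_eq_add_of_le' hN2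
    have hn : ¬ n + 2 = 1 := by omega
    have hBpos : 0 < ((n + 2 : ℕ) : ℝ) / (μ * (((n + 2 : ℕ) : ℝ) - 1)) := by
      push_cast
      rw [show (n : ℝ) + 2 - 1 = n + 1 by ring]
      positivity
    simp only [highSNRApprox, if_neg hn]
    refine highSNR_of_tendsto_sub hγ hBpos (Eventually.of_forall fun _ => le_rfl) ?_ ?_
    · exact (isLittleO_const_left.2 (.inr (tendsto_norm_atTop_atTop.comp
        Real.tendsto_log_atTop))).isBigO
    · have hc0 : Tendsto (fun ρ : ℝ => (((n + 2 : ℕ) : ℝ) * ρ + ρI + 1) / (μ * ρ)) atTop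
          (𝓝 (((n + 2 : ℕ) : ℝ) / μ)) := by
        have h := (hε0.const_mul ((ρI + 1) / (μ * γth))).const_add (((n + 2 : ℕ) : ℝ) / μ)
        rw [mul_zero, add_zero] at h
        exact h.congr' (hceq.mono fun _ h => h.symm)
      have hcpos : ∀ᶠ ρ : ℝ in atTop, 0 < (((n + 2 : ℕ) : ℝ) * ρ + ρI + 1) / (μ * ρ) := by
        filter_upwards [eventually_gt_atTop 0] with ρ hρ
        positivity
      have h := (tendsto_normalizedOutage_div (n := n) hρI hεpos hε0 hcpos hc0).sub_const
        (((n + 2 : ℕ) : ℝ) / (μ * (((n + 2 : ℕ) : ℝ) - 1)))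
      convert! h using 2
      push_cast
      rw [show (n : ℝ) + 2 - 1 = n + 1 by ring]
      field_simp
      ring

end DualHop

theorem theorem2 {ι : Type*} (l : Filter ι) (S : ι → DualHop.SystemParams)
    (N : ℕ) (hN : 1 ≤ N) (μ ρI γth : ℝ) (hμ : 0 < μ) (hγ : 0 < γth)
    (hρI : ∀ i, (S i).rhoI = ρI)
    (hρ2 : ∀ i, (S i).rho2 = μ * (S i).rho1)
    (hρ1 : Tendsto (fun i => (S i).rho1) l atTop) :
    ((fun i => DualHop.outageProb (S i) N γth
        - DualHop.highSNRApprox N μ ρI γth (S i).rho1) =o[l] fun i => 1 / (S i).rho1) ∧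
    ((fun i => DualHop.outageProb (S i) N γth) ~[l]
      fun i => DualHop.highSNRApprox N μ ρI γth (S i).rho1) ∧
    Tendsto (fun i => -Real.log (DualHop.outageProb (S i) N γth) / Real.log (S i).rho1)
      l (𝓝 1) := by
  -- `0 ≤ ρI` is a property of the systems `S i`, so it needs an index
  rcases isEmpty_or_nonempty ι with hι | ⟨⟨i₀⟩⟩
  · rw [filter_eq_bot_of_isEmpty l]
    simp [IsEquivalent]
  have hρI0 : 0 ≤ ρI := hρI i₀ ▸ (S i₀).rhoI_nonneg
  simp_rw [DualHop.outageProb_eq_normalizedOutage, hρI, hρ2]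
  obtain ⟨h1, h2, h3⟩ := DualHop.outage_asymptotics N hN hμ hρI0 hγ
  exact ⟨h1.comp_tendsto hρ1, h2.comp_tendsto hρ1, h3.comp hρ1⟩
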